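/- Let $M$ be a nonempty smooth manifold of dimension $2n+1$ with $n\ge 1$, equipped with a contact metric structure $(\eta,\xi,\phi,g)$: $\eta$ is a contact form ($\eta\wedge(d\eta)^n\neq 0$ everywhere), $\xi$ is its characteristic vector field ($\eta(\xi)=1$, $d\eta(\xi,\cdot)=0$), $g$ is a Riemannian metric and $\phi$ is a $(1,1)$-tensor field with $\eta(X)=g(X,\xi)$, $d\eta(X,Y)=g(X,\phi Y)$ and $\phi^2X=-X+\eta(X)\xi$ for all vector fields $X,Y$, where $d\eta(X,Y)=\tfrac12\bigl(X\eta(Y)-Y\eta(X)-\eta([X,Y])\bigr)$. Let $\nabla$ be the Levi-Civita connection of $g$ and $R(X,Y)Z=\nabla_X\nabla_YZ-\nabla_Y\nabla_XZ-\nabla_{[X,Y]}Z$ its curvature tensor. Call $M$ $\phi$-recurrent if there is a smooth 1-form $A$, not identically zero, such that $$\phi^2\bigl((\nabla_WR)(X,Y)Z\bigr)=A(W)\,R(X,Y)Z$$ for all vector fields $X,Y,Z,W$. Then $M$ is $\phi$-recurrent and of constant curvature (that is, $R(X,Y)Z=c\,[g(Y,Z)X-g(X,Z)Y]$ for some constant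 $c\in\mathbb{R}$ and all vector fields $X,Y,Z$) if and only if $n=1$ and $g$ is flat ($R=0$). In other words, the $\phi$-recurrent contact metric manifolds of constant curvature are exactly the flat contact metric manifolds of dimension 3. -/

import Mathlib

open Bundle VectorField
open scoped Manifold ContDiff

noncomputable section

section DifferentialForms

variable {E : Type*} [NormedAddCommGroup E] [NormedSpace ℝ E]
  {H : Type*} [TopologicalSpace H] (I : ModelWithCorners ℝ E H)
  {M : Type*} [TopologicalSpace M] [ChartedSpace H M] [IsManifold I ∞ M]

/-- Smooth vector fields, as smooth sections of the tangent bundle. -/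
def IsSmoothVectorField (X : Π p : M, TangentSpace I p) : Prop :=
  ContMDiff I (I.prod 𝓘(ℝ, E)) ∞
    (fun p => TotalSpace.mk' E (E := fun q : M => TangentSpace I q) p (X p))

/-- Smooth 1-forms, as smooth sections of the cotangent bundle. -/
def IsSmoothOneForm (α : Π p : M, TangentSpace I p →L[ℝ] ℝ) : Prop :=
  ContMDiff I (I.prod 𝓘(ℝ, E →L[ℝ] ℝ)) ∞ (fun p => TotalSpace.mk' (E →L[ℝ] ℝ)
    (E := fun q : M => TangentSpace I q →L[ℝ] Trivial M ℝ q) p (α p))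

/-- Smooth tensor fields of type (1, 1), as smooth sections of the endomorphism bundle. -/
def IsSmoothEndomorphism (φ : Π p : M, TangentSpace I p →L[ℝ] TangentSpace I p) : Prop :=
  ContMDiff I (I.prod 𝓘(ℝ, E →L[ℝ] E)) ∞ (fun p => TotalSpace.mk' (E →L[ℝ] E)
    (E := fun q : M => TangentSpace I q →L[ℝ] TangentSpace I q) p (φ p))

/-- The exterior derivative of a 1-form, evaluated on vector fields, in the normalization
`dα(X, Y) = (X(α(Y)) - Y(α(X)) - α([X, Y])) / 2` customary in contact metric geometry. -/
def extDerivOneForm (α : Π p : M, TangentSpace I p →L[ℝ] ℝ) (X Y : Π p : M, TangentSpace I p)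
    (p : M) : ℝ :=
  (1 / 2 : ℝ) * (mvfderiv I (fun q => α q (Y q)) p (X p)
    - mvfderiv I (fun q => α q (X q)) p (Y p) - α p (mlieBracket I X Y p))

/-- The value of the top-degree form `α ∧ (dα)^n` on `2n + 1` vector fields at the point `p`: the
alternation of `α ⊗ dα ⊗ ⋯ ⊗ dα`. -/
def contactVolume (n : ℕ) (α : Π p : M, TangentSpace I p →L[ℝ] ℝ)
    (V : Fin (2 * n + 1) → Π p : M, TangentSpace I p) (p : M) : ℝ :=
  (1 / (Nat.factorial (2 * n + 1) : ℝ)) * ∑ σ : Equiv.Perm (Fin (2 * n + 1)),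
    ((Equiv.Perm.sign σ : ℤ) : ℝ) * (α p (V (σ 0) p) *
      ∏ i : Fin n, extDerivOneForm I α (V (σ ⟨2 * (i : ℕ) + 1, by omega⟩))
        (V (σ ⟨2 * (i : ℕ) + 2, by omega⟩)) p)

/-- A contact form on a `(2n + 1)`-dimensional manifold: a smooth 1-form `η` such that
`η ∧ (dη)^n` vanishes nowhere. -/
def IsContactForm (n : ℕ) (η : Π p : M, TangentSpace I p →L[ℝ] ℝ) : Prop :=
  IsSmoothOneForm I η ∧ ∀ p : M, ∃ V : Fin (2 * n + 1) → Π q : M, TangentSpace I q,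
    (∀ i, IsSmoothVectorField I (V i)) ∧ contactVolume I n η V p ≠ 0

end DifferentialForms

section ContactMetric

variable {E : Type*} [NormedAddCommGroup E] [NormedSpace ℝ E]
  {H : Type*} [TopologicalSpace H] (I : ModelWithCorners ℝ E H)
  {M : Type*} [TopologicalSpace M] [ChartedSpace H M]
  [RiemannianBundle (fun p : M => TangentSpace I p)]

/-- The right-hand side of the Koszul formula, which is `2 g(∇_X Y, Z)`. The Riemannian metric `g`
is the inner product `inner ℝ` on the tangent spaces. -/
def koszul (X Y Z : Π p : M, TangentSpace I p) (p : M) : ℝ :=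
  mvfderiv I (fun q => inner ℝ (Y q) (Z q)) p (X p)
    + mvfderiv I (fun q => inner ℝ (Z q) (X q)) p (Y p)
    - mvfderiv I (fun q => inner ℝ (X q) (Y q)) p (Z p)
    - inner ℝ (X p) (mlieBracket I Y Z p)
    - inner ℝ (Y p) (mlieBracket I X Z p)
    + inner ℝ (Z p) (mlieBracket I X Y p)

variable [IsManifold I ∞ M]
  [IsContMDiffRiemannianBundle I ∞ E (fun p : M => TangentSpace I p)]

theorem mdiffAt_inner {X Y : Π p : M, TangentSpace I p} {p : M}
    (hX : MDiffAt (T% X) p) (hY : MDiffAt (T% Y) p) :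
    MDiffAt (fun q => inner ℝ (X q) (Y q)) p :=
  MDifferentiableAt.inner_bundle (F := E) (E := fun p : M => TangentSpace I p) (b := id) hX hY

variable [FiniteDimensional ℝ E]

theorem tensorialAt_koszul_left {Y Z : Π p : M, TangentSpace I p} {p : M}
    (hY : MDiffAt (T% Y) p) (hZ : MDiffAt (T% Z) p) :
    TensorialAt I E (fun X => koszul I X Y Z p) p where
  smul {f X} hf hX := by
    simp only [koszul]
    have h1 : (fun q => inner ℝ (Z q) ((f • X) q)) = fun q => f q * inner ℝ (Z q) (X q) := by
      ext q; simp [inner_smul_right]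
    have h2 : (fun q => inner ℝ ((f • X) q) (Y q)) = fun q => f q * inner ℝ (X q) (Y q) := by
      ext q; simp [inner_smul_left]
    have : CompleteSpace E := FiniteDimensional.complete ℝ E
    rw [h1, h2, mvfderiv_fun_mul hf (mdiffAt_inner I hZ hX),
      mvfderiv_fun_mul hf (mdiffAt_inner I hX hY),
      mlieBracket_smul_left hf hX, mlieBracket_smul_left hf hX]
    simp [inner_smul_left, inner_smul_right, inner_add_right, real_inner_comm]
    ring
  add {X X'} hX hX' := by
    simp only [koszul]
    have h1 : (fun q => inner ℝ (Z q) ((X + X') q)) =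
        fun q => inner ℝ (Z q) (X q) + inner ℝ (Z q) (X' q) := by
      ext q; simp [inner_add_right]
    have h2 : (fun q => inner ℝ ((X + X') q) (Y q)) =
        fun q => inner ℝ (X q) (Y q) + inner ℝ (X' q) (Y q) := by
      ext q; simp [inner_add_left]
    have : CompleteSpace E := FiniteDimensional.complete ℝ E
    rw [h1, h2, mvfderiv_fun_add (mdiffAt_inner I hZ hX) (mdiffAt_inner I hZ hX'),
      mvfderiv_fun_add (mdiffAt_inner I hX hY) (mdiffAt_inner I hX' hY),
      mlieBracket_add_left hX hX', mlieBracket_add_left hX hX']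
    simp [inner_add_left, inner_add_right]
    ring

theorem tensorialAt_koszul_right {X Y : Π p : M, TangentSpace I p} {p : M}
    (hX : MDiffAt (T% X) p) (hY : MDiffAt (T% Y) p) :
    TensorialAt I E (fun Z => koszul I X Y Z p) p where
  smul {f Z} hf hZ := by
    simp only [koszul]
    have h1 : (fun q => inner ℝ (Y q) ((f • Z) q)) = fun q => f q * inner ℝ (Y q) (Z q) := by
      ext q; simp [inner_smul_right]
    have h2 : (fun q => inner ℝ ((f • Z) q) (X q)) = fun q => f q * inner ℝ (Z q) (X q) := by
      ext q; simp [inner_smul_left]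
    have : CompleteSpace E := FiniteDimensional.complete ℝ E
    rw [h1, h2, mvfderiv_fun_mul hf (mdiffAt_inner I hY hZ),
      mvfderiv_fun_mul hf (mdiffAt_inner I hZ hX),
      mlieBracket_smul_right hf hZ, mlieBracket_smul_right hf hZ]
    simp [inner_smul_left, inner_smul_right, inner_add_right, real_inner_comm]
    ring
  add {Z Z'} hZ hZ' := by
    simp only [koszul]
    have h1 : (fun q => inner ℝ (Y q) ((Z + Z') q)) =
        fun q => inner ℝ (Y q) (Z q) + inner ℝ (Y q) (Z' q) := by
      ext q; simp [inner_add_right]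
    have h2 : (fun q => inner ℝ ((Z + Z') q) (X q)) =
        fun q => inner ℝ (Z q) (X q) + inner ℝ (Z' q) (X q) := by
      ext q; simp [inner_add_left]
    have : CompleteSpace E := FiniteDimensional.complete ℝ E
    rw [h1, h2, mvfderiv_fun_add (mdiffAt_inner I hY hZ) (mdiffAt_inner I hY hZ'),
      mvfderiv_fun_add (mdiffAt_inner I hZ hX) (mdiffAt_inner I hZ' hX),
      mlieBracket_add_right hZ hZ', mlieBracket_add_right hZ hZ']
    simp [inner_add_left, inner_add_right]
    ring

/-- The linear map `X ↦ ∇_X Y` on the tangent space at `p`, obtained from the Koszul formula. -/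
theorem exists_koszul_vector (Y : Π p : M, TangentSpace I p) (p : M) :
    ∃ L : TangentSpace I p →L[ℝ] TangentSpace I p, MDiffAt (T% Y) p →
      ∀ X Z : Π q : M, TangentSpace I q, MDiffAt (T% X) p → MDiffAt (T% Z) p →
        2 * inner ℝ (L (X p)) (Z p) = koszul I X Y Z p := by
  classical
  by_cases hY : MDiffAt (T% Y) p
  swap
  · exact ⟨0, fun h => absurd h hY⟩
  have : FiniteDimensional ℝ (TangentSpace I p) := inferInstanceAs (FiniteDimensional ℝ E)
  have : CompleteSpace (TangentSpace I p) := FiniteDimensional.complete ℝ _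
  let B := TensorialAt.mkHom₂ (F := E) (F' := E) (I := I) (fun X Z => koszul I X Y Z p) p
    (fun Z hZ => tensorialAt_koszul_left I hY hZ) (fun X hX => tensorialAt_koszul_right I hX hY)
  let T : TangentSpace I p →L[ℝ] TangentSpace I p :=
    (1 / 2 : ℝ) • LinearMap.toContinuousLinearMap
      ((InnerProductSpace.toDual ℝ (TangentSpace I p)).symm.toLinearEquiv.toLinearMap ∘ₗ
        B.toLinearMap)
  refine ⟨T, fun _ X Z hX hZ => ?_⟩
  have hB : B (X p) (Z p) = koszul I X Y Z p := TensorialAt.mkHom₂_apply _ _ hX hZ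
  rw [← hB]
  simp [T, inner_smul_left]

theorem koszul_add_middle {X Y Y' Z : Π p : M, TangentSpace I p} {p : M}
    (hX : MDiffAt (T% X) p) (hY : MDiffAt (T% Y) p) (hY' : MDiffAt (T% Y') p)
    (hZ : MDiffAt (T% Z) p) :
    koszul I X (Y + Y') Z p = koszul I X Y Z p + koszul I X Y' Z p := by
  simp only [koszul]
  have h1 : (fun q => inner ℝ ((Y + Y') q) (Z q)) =
      fun q => inner ℝ (Y q) (Z q) + inner ℝ (Y' q) (Z q) := by
    ext q; simp [inner_add_left]
  have h2 : (fun q => inner ℝ (X q) ((Y + Y') q)) =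
      fun q => inner ℝ (X q) (Y q) + inner ℝ (X q) (Y' q) := by
    ext q; simp [inner_add_right]
  have : CompleteSpace E := FiniteDimensional.complete ℝ E
  rw [h1, h2, mvfderiv_fun_add (mdiffAt_inner I hY hZ) (mdiffAt_inner I hY' hZ),
    mvfderiv_fun_add (mdiffAt_inner I hX hY) (mdiffAt_inner I hX hY'),
    mlieBracket_add_left hY hY', mlieBracket_add_right hY hY']
  simp [inner_add_left, inner_add_right]
  ring

theorem koszul_smul_middle {X Y Z : Π p : M, TangentSpace I p} {f : M → ℝ} {p : M}
    (hX : MDiffAt (T% X) p) (hY : MDiffAt (T% Y) p) (hZ : MDiffAt (T% Z) p) (hf : MDiffAt f p) :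
    koszul I X (f • Y) Z p =
      f p * koszul I X Y Z p + 2 * (mvfderiv I f p (X p) * inner ℝ (Y p) (Z p)) := by
  simp only [koszul]
  have h1 : (fun q => inner ℝ ((f • Y) q) (Z q)) = fun q => f q * inner ℝ (Y q) (Z q) := by
    ext q; simp [inner_smul_left]
  have h2 : (fun q => inner ℝ (X q) ((f • Y) q)) = fun q => f q * inner ℝ (X q) (Y q) := by
    ext q; simp [inner_smul_right]
  have : CompleteSpace E := FiniteDimensional.complete ℝ E
  rw [h1, h2, mvfderiv_fun_mul hf (mdiffAt_inner I hY hZ),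
    mvfderiv_fun_mul hf (mdiffAt_inner I hX hY),
    mlieBracket_smul_left hf hY, mlieBracket_smul_right hf hY]
  simp [inner_smul_left, inner_smul_right, inner_add_right, real_inner_comm]
  ring

/-- A Riemannian manifold carries a torsion-free metric connection. -/
theorem exists_torsionFree_metric_connection :
    ∃ cov : CovariantDerivative I E (TangentSpace I : M → Type _),
      (haveI : CompleteSpace E := FiniteDimensional.complete ℝ E
       cov.torsion = 0) ∧ cov.IsMetricCompatible := by
  have : CompleteSpace E := FiniteDimensional.complete ℝ E
  choose L hL using fun (Y : Π p : M, TangentSpace I p) (p : M) => exists_koszul_vector I Y p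
  have key : ∀ {p : M} {u v : TangentSpace I p},
      (∀ w : TangentSpace I p, (2 : ℝ) * inner ℝ u w = 2 * inner ℝ v w) → u = v := by
    intro p u v h
    exact ext_inner_right ℝ fun w => by have := h w; linarith
  have hE : ∀ {p : M} (w : TangentSpace I p),
      MDiffAt (T% (FiberBundle.extend E w : Π q : M, TangentSpace I q)) p :=
    fun w => FiberBundle.mdifferentiableAt_extend ..
  have hL' : ∀ {Y X Z : Π p : M, TangentSpace I p} {p : M}, MDiffAt (T% X) p → MDiffAt (T% Y) p →
      MDiffAt (T% Z) p → 2 * inner ℝ (L Y p (X p)) (Z p) = koszul I X Y Z p :=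
    fun {Y X Z p} hX hY hZ => hL Y p hY X Z hX hZ
  let cov : CovariantDerivative I E (TangentSpace I : M → Type _) :=
    { toFun := L
      isCovariantDerivativeOnUniv :=
        { add := by
            intro Y Y' p hY hY' _
            ext v
            refine key fun w => ?_
            have h0 := hL' (hE v) (mdifferentiableAt_add_section hY hY') (hE w)
            have h1 := hL' (hE v) hY (hE w)
            have h2 := hL' (hE v) hY' (hE w)
            rw [koszul_add_middle I (hE v) hY hY' (hE w), ← h1, ← h2] at h0
            simp only [FiberBundle.extend_apply_self] at h0
            rw [h0]
            simp [inner_add_left]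
            ring
          leibniz := by
            intro Y f p hY hf _
            ext v
            refine key fun w => ?_
            have h0 := hL' (hE v) (hf.smul_section hY) (hE w)
            have h1 := hL' (hE v) hY (hE w)
            rw [koszul_smul_middle I (hE v) hY (hE w) hf, ← h1] at h0
            simp only [FiberBundle.extend_apply_self] at h0
            rw [h0]
            simp [inner_add_left, inner_smul_left]
            ring } }
  refine ⟨cov, ?_, ?_⟩
  · rw [CovariantDerivative.torsion_eq_zero_iff]
    intro X Y p hX hY
    change L Y p (X p) - L X p (Y p) = _
    refine key fun w => ?_
    have h0 := hL' hX hY (hE w)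
    have h1 := hL' hY hX (hE w)
    simp only [FiberBundle.extend_apply_self] at h0 h1
    rw [inner_sub_left, mul_sub, h0, h1]
    simp only [koszul]
    rw [mlieBracket_swap_apply (V := Y) (W := X)]
    simp [real_inner_comm]
    ring
  · rw [CovariantDerivative.isMetricCompatible_iff]
    intro p X Y Z hX hY hZ
    change mvfderiv I _ p (X p) = inner ℝ (L Y p (X p)) (Z p) + inner ℝ (Y p) (L Z p (X p))
    have h0 := hL' hX hY hZ
    have h1 := hL' hX hZ hY
    rw [real_inner_comm _ (Y p)]
    simp only [koszul] at h0 h1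
    rw [mlieBracket_swap_apply (V := Z) (W := Y)] at h1
    simp only [real_inner_comm, inner_neg_right] at h0 h1 ⊢
    linarith

/-- The Levi-Civita connection: the torsion-free connection compatible with the metric. It is unique
on differentiable vector fields. As in Mathlib, `leviCivita I Y p (X p)` is `(∇_X Y)(p)`. -/
def leviCivita : CovariantDerivative I E (TangentSpace I : M → Type _) :=
  (exists_torsionFree_metric_connection I (M := M)).choose


theorem leviCivita_isMetricCompatible :
    CovariantDerivative.IsMetricCompatible (V := fun p : M => TangentSpace I p) (leviCivita I) :=
  (exists_torsionFree_metric_connection I (M := M)).choose_spec.2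

theorem leviCivita_torsion [CompleteSpace E] : (leviCivita I (M := M)).torsion = 0 :=
  (exists_torsionFree_metric_connection I (M := M)).choose_spec.1

/-- The vector field `∇_X Y`. -/
def nabla (X Y : Π p : M, TangentSpace I p) : Π p : M, TangentSpace I p :=
  fun p => leviCivita I Y p (X p)

/-- The vector field `R(X, Y)Z = ∇_X ∇_Y Z - ∇_Y ∇_X Z - ∇_{[X, Y]} Z`. -/
def curvature (X Y Z : Π p : M, TangentSpace I p) : Π p : M, TangentSpace I p :=
  fun p => nabla I X (nabla I Y Z) p - nabla I Y (nabla I X Z) p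
    - nabla I (mlieBracket I X Y) Z p

/-- The vector field `(∇_W R)(X, Y)Z`. -/
def nablaCurvature (W X Y Z : Π p : M, TangentSpace I p) : Π p : M, TangentSpace I p :=
  fun p => nabla I W (curvature I X Y Z) p - curvature I (nabla I W X) Y Z p
    - curvature I X (nabla I W Y) Z p - curvature I X Y (nabla I W Z) p

/-- `(M, g)` has constant curvature `c`. -/
def HasConstantCurvature (M : Type*) [TopologicalSpace M] [ChartedSpace H M]
    [RiemannianBundle (fun p : M => TangentSpace I p)] [IsManifold I ∞ M]
    [IsContMDiffRiemannianBundle I ∞ E (fun p : M => TangentSpace I p)] (c : ℝ) : Prop :=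
  ∀ X Y Z : Π p : M, TangentSpace I p, IsSmoothVectorField I X → IsSmoothVectorField I Y →
    IsSmoothVectorField I Z → ∀ p : M, curvature I X Y Z p =
      c • ((inner ℝ (Y p) (Z p) : ℝ) • X p - (inner ℝ (X p) (Z p) : ℝ) • Y p)

/-- `(M, g)` is flat: its curvature tensor vanishes. -/
def IsFlat (M : Type*) [TopologicalSpace M] [ChartedSpace H M]
    [RiemannianBundle (fun p : M => TangentSpace I p)] [IsManifold I ∞ M]
    [IsContMDiffRiemannianBundle I ∞ E (fun p : M => TangentSpace I p)] : Prop :=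
  ∀ X Y Z : Π p : M, TangentSpace I p, IsSmoothVectorField I X → IsSmoothVectorField I Y →
    IsSmoothVectorField I Z → ∀ p : M, curvature I X Y Z p = 0

/-- A contact metric structure `(η, ξ, φ, g)` on a `(2n + 1)`-dimensional manifold, where `g` is the
given Riemannian metric: `η` is a contact form, `ξ` its characteristic vector field, and `g` and `φ`
are associated to `η`. -/
structure ContactMetricStructure (n : ℕ) (M : Type*) [TopologicalSpace M] [ChartedSpace H M]
    [RiemannianBundle (fun p : M => TangentSpace I p)] [IsManifold I ∞ M] where
  η : Π p : M, TangentSpace I p →L[ℝ] ℝ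
  ξ : Π p : M, TangentSpace I p
  φ : Π p : M, TangentSpace I p →L[ℝ] TangentSpace I p
  isContactForm : IsContactForm I n η
  smooth_ξ : IsSmoothVectorField I ξ
  smooth_φ : IsSmoothEndomorphism I φ
  η_ξ : ∀ p : M, η p (ξ p) = 1
  dη_ξ : ∀ X : Π p : M, TangentSpace I p, IsSmoothVectorField I X →
    ∀ p : M, extDerivOneForm I η ξ X p = 0
  η_eq : ∀ (p : M) (v : TangentSpace I p), η p v = inner ℝ v (ξ p)
  dη_eq : ∀ X Y : Π p : M, TangentSpace I p, IsSmoothVectorField I X → IsSmoothVectorField I Y →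
    ∀ p : M, extDerivOneForm I η X Y p = inner ℝ (X p) (φ p (Y p))
  φ_sq : ∀ (p : M) (v : TangentSpace I p), φ p (φ p v) = -v + η p v • ξ p

variable {I} in
/-- A contact metric manifold is `φ`-recurrent if there is a 1-form `A`, not identically zero, with
`φ²((∇_W R)(X, Y)Z) = A(W) R(X, Y)Z` for all vector fields `X, Y, Z, W`. -/
def ContactMetricStructure.IsPhiRecurrent {n : ℕ} (S : ContactMetricStructure I n M) : Prop :=
  ∃ A : Π p : M, TangentSpace I p →L[ℝ] ℝ, IsSmoothOneForm I A ∧ A ≠ 0 ∧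
    ∀ W X Y Z : Π p : M, TangentSpace I p, IsSmoothVectorField I W → IsSmoothVectorField I X →
      IsSmoothVectorField I Y → IsSmoothVectorField I Z → ∀ p : M,
        S.φ p (S.φ p (nablaCurvature I W X Y Z p)) = A p (W p) • curvature I X Y Z p

end ContactMetric

end

/-! Constant curvature forces `∇R = 0`, so recurrence reads `A(W) R = 0`. Where `A ≠ 0`, `R(X, ξ)ξ =
c (X - η(X)ξ)` then gives `c = 0`. Conversely a flat structure satisfies the recurrence with `A =
η`, both sides being zero. What remains is that a flat contact metric manifold has dimension at most
3.

Let `A` now denote `∇ξ`. The contact condition makes its adjoint `T = A + 2φ`, and flatness makes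
the Hessian `∇²ξ` symmetric, whence `∇_ξ A = -A²` and `∇_ξ T = -T²`. Differentiating `φ² = -1 + η ⊗
ξ` along `ξ` yields `A² = T²`; differentiating this along `ξ` yields `A³ = T³`, and so `A² = T² = 0`
(`gradξ_gradξ`). Expanding `T² = 0` gives `AT + TA = 4(1 - η ⊗ ξ)`.

The derivatives of these identities determine the Hessian completely: `∇²_{X,Y}ξ = -⟨AX, AY⟩ ξ`
(`hessian_eq_of_flat`). Commuting derivatives on `AX` then gives a Gauss-type equation, `|AX|²|AZ|²
= ⟨AX, AZ⟩²` (`inner_gradξ_sq`), so `A` has rank at most 1. If `a` spans its range, the formula for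
`AT + TA` shows that `ξ`, `a`, `Ta` span the tangent space. -/

noncomputable section

/-! ### Linear algebra of `A = ∇ξ` and its adjoint `T` at a point. -/

section LinearAlgebra

variable {V : Type*} [NormedAddCommGroup V] [InnerProductSpace ℝ V] {A T φ : V →ₗ[ℝ] V} {ξ : V}

/-- If `φ² = -1 + ξ ⊗ ξ`, `T = A + 2φ`, and `φ` anticommutes with `A² - T²`, then `A² = T²`. -/
theorem sq_eq_sq_of_anticommute (hφ : ∀ v, φ (φ v) = -v + (inner ℝ v ξ : ℝ) • ξ)
    (hT : ∀ v, T v = A v + (2 : ℝ) • φ v) (hAξ : A ξ = 0) (hTξ : T ξ = 0)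
    (hξA : ∀ v, inner ℝ (A v) ξ = (0 : ℝ)) (hξT : ∀ v, inner ℝ (T v) ξ = (0 : ℝ))
    (h : ∀ v, φ (A (A v) - T (T v)) + (A (A (φ v)) - T (T (φ v))) = 0) (v : V) :
    A (A v) = T (T v) := by
  -- `S = A + T` satisfies `S = φ S φ`, whence `φ S = - S φ`
  have hφ' : ∀ v, φ v = (1 / 2 : ℝ) • (T v - A v) := fun v => by rw [hT]; module
  have e1 : ∀ v, A (A v) - T (T v) = -(A (φ v) + T (φ v)) - φ (A v + T v) := fun v => by
    simp only [hφ', map_smul, map_sub, map_add]; module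
  have hS : ∀ v, φ (A (φ v) + T (φ v)) = A v + T v := fun v => by
    have h1 := h v
    rw [e1, e1] at h1
    have h2 : A (φ (φ v)) + T (φ (φ v)) = -(A v + T v) := by
      rw [hφ]; simp [hAξ, hTξ]; abel
    have h3 : φ (φ (A v + T v)) = -(A v + T v) := by
      rw [hφ]; simp [inner_add_left, hξA, hξT]
    rw [map_sub, map_neg, h2, h3] at h1
    have : (2 : ℝ) • (φ (A (φ v) + T (φ v))) = (2 : ℝ) • (A v + T v) := by
      rw [← sub_eq_zero, ← neg_eq_zero, ← h1]; module
    exact smul_right_injective V (two_ne_zero (α := ℝ)) this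
  have h4 : φ (A v + T v) = -(A (φ v) + T (φ v)) := by
    rw [← hS v, hφ]; simp [inner_add_left, hξA, hξT]
  rw [← sub_eq_zero, e1, h4]; abel

/-- If moreover `A² = T²` and `A³ = T³`, then `A² = 0`. -/
theorem sq_eq_zero_of_cube_eq_cube (hφ : ∀ v, φ (φ v) = -v + (inner ℝ v ξ : ℝ) • ξ)
    (hT : ∀ v, T v = A v + (2 : ℝ) • φ v) (hξA : ∀ v, inner ℝ (A v) ξ = (0 : ℝ))
    (h2 : ∀ v, A (A v) = T (T v)) (h3 : ∀ v, A (A (A v)) = T (T (T v))) (v : V) :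
    A (A v) = 0 := by
  -- `T A² = A³ + 2φA²`, while `T A² = T³ = A³`.
  have h : φ (A (A v)) = 0 := by
    have h4 := hT (A (A v))
    rw [h3, h2] at h4
    have : (2 : ℝ) • φ (T (T v)) = 0 := by simpa using h4.symm
    rw [h2]
    simpa using this
  have h5 := hφ (A (A v))
  rw [h, map_zero, hξA, zero_smul, add_zero] at h5
  exact neg_eq_zero.1 h5.symm

/-- The algebraic determination of the second covariant derivative `b` of the characteristic
vector field `ξ` of a flat contact metric structure in terms of `A = ∇ξ` and its adjoint `T`. -/
theorem hessian_eq_of_flat {b : V → V → V}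
    (hadd : ∀ u v w, b u (v + w) = b u v + b u w) (hsmul : ∀ u (r : ℝ) v, b u (r • v) = r • b u v)
    (hsymm : ∀ u v, b u v = b v u) (hξ : inner ℝ ξ ξ = (1 : ℝ))
    (hadj : ∀ u v, inner ℝ (A u) v = (inner ℝ u (T v) : ℝ))
    (hAA : ∀ v, A (A v) = 0) (hTT : ∀ v, T (T v) = 0) (hAξ : A ξ = 0) (hTξ : T ξ = 0)
    (hAT : ∀ v, A (T v) + T (A v) = (4 : ℝ) • (v - (inner ℝ v ξ : ℝ) • ξ))
    (hbξ : ∀ u, b u ξ = 0) (hbA : ∀ u v, b u (A v) = -A (b u v))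
    (hξb : ∀ u v, inner ℝ (b u v) ξ = -(inner ℝ (A u) (A v) : ℝ))
    (hder : ∀ x y z, inner ℝ y (b x (T z)) + inner ℝ z (b x (T y)) + inner ℝ (b x y) (A z)
      + inner ℝ (A y) (b x z) =
        -4 * ((inner ℝ y (A x) : ℝ) * inner ℝ z ξ + (inner ℝ y ξ : ℝ) * inner ℝ z (A x)))
    (u v : V) : b u v = -(inner ℝ (A u) (A v) : ℝ) • ξ := by
  have hdec : ∀ v, v = (inner ℝ v ξ : ℝ) • ξ + (1 / 4 : ℝ) • (A (T v) + T (A v)) := fun v => by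
    rw [hAT]; module
  have hadj' : ∀ u v, inner ℝ (T u) v = (inner ℝ u (A v) : ℝ) := fun u v => by
    rw [real_inner_comm, ← hadj, real_inner_comm]
  have hb0 : ∀ u, b u 0 = 0 := fun u => by simpa using hsmul u 0 0
  have hbA' : ∀ u v, b (A u) v = -A (b u v) := fun u v => by
    rw [hsymm, hbA, hsymm]
  -- `hder` at `(Ax, Ty, z)`: the other terms die by `A² = T² = 0`.
  have h1 : ∀ x y z, inner ℝ (A (b x (T y))) (A z) + (inner ℝ (A (T y)) (A (b x z)) : ℝ) = 0 := by
    intro x y z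
    have := hder (A x) (T y) z
    simp only [hbA', hAA, hTT, hb0, map_zero, inner_neg_left, inner_neg_right, inner_zero_right,
      neg_zero, add_zero, mul_zero, zero_mul] at this
    rw [← hadj' (T y), hTT, inner_zero_left] at this
    linarith
  have hξA : ∀ v, inner ℝ (A v) ξ = (0 : ℝ) := fun v => by rw [hadj, hTξ, inner_zero_right]
  have hξT : ∀ v, inner ℝ (T v) ξ = (0 : ℝ) := fun v => by rw [hadj', hAξ, inner_zero_right]
  -- By `hdec`, `ξ` and the ranges of `AT` and `TA` span `V`.
  have hzero : ∀ w : V, inner ℝ w ξ = (0 : ℝ) → (∀ z, inner ℝ w (A (T z)) = (0 : ℝ)) →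
      (∀ z, inner ℝ w (T (A z)) = (0 : ℝ)) → w = 0 := by
    intro w h1 h2 h3
    rw [← inner_self_eq_zero (𝕜 := ℝ)]
    nth_rewrite 2 [hdec w]
    rw [inner_add_right, inner_smul_right, inner_smul_right, inner_add_right, h1, h2, h3]
    simp
  -- The six-permutation argument, as in the uniqueness of the Levi-Civita connection.
  have hcyc : ∀ c : V → V → V → ℝ, (∀ x y z, c x y z = c y x z) →
      (∀ x y z, c x y z = -c x z y) → ∀ x y z, c x y z = 0 := by
    intro c hs ha x y z
    linarith [ha x y z, hs x z y, ha z x y, hs z y x, ha y z x, hs y x z]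
  have hdec₂ : ∀ u v, b u v = (1 / 4 : ℝ) • (-A (b u (T v)) + b u (T (A v))) := fun u v => by
    nth_rewrite 1 [hdec v]
    rw [hadd, hsmul, hbξ, hsmul, hadd, hbA]
    simp
  -- the part of `b` in the range of `T` vanishes
  have hAb : ∀ u v, A (b u v) = 0 := by
    have h2 : ∀ x y, A (b (T x) (T y)) = 0 := by
      intro x y
      refine hzero _ (hξA _) (fun z => ?_) (fun z => by rw [← hadj, hAA, inner_zero_left])
      refine hcyc (fun x y z => inner ℝ (A (b (T x) (T y))) (A (T z))) ?_ ?_ x y z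
      · intro x y z; simp only [hsymm]
      · intro x y z
        have := h1 (T x) y (T z)
        rw [real_inner_comm (A (b (T x) (T z)))] at this
        linarith
    have h3 : ∀ u v, A (b u v) = (1 / 4 : ℝ) • A (b u (T (A v))) := fun u v => by
      rw [hdec₂, map_smul, map_add, map_neg, hAA]; simp
    intro u v
    rw [h3, hsymm, h3, h2]; simp
  have hbT : ∀ u v, b u v = (1 / 16 : ℝ) • b (T (A u)) (T (A v)) := fun u v => by
    rw [hdec₂ u v, hAb, hsymm u, hdec₂ _ u, hAb, hsymm]; module
  have hTAT : ∀ v, T (A (T v)) = (4 : ℝ) • T v := fun v => by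
    have := hAT (T v)
    rwa [hTT, map_zero, zero_add, hξT, zero_smul, sub_zero] at this
  -- `hder` at `(Tx, ATy, ATz)`, with `TAT = 4T` and `A b = 0`, gives skewness in the last two
  -- arguments, so `hcyc` applies on the range of `T`; `hbT` reduces the general case to that one.
  have hbAT : ∀ x y z, inner ℝ (b x y) (A (T z)) = (0 : ℝ) := by
    have h2 : ∀ x y z, inner ℝ (b (T x) (T y)) (A (T z)) = (0 : ℝ) := by
      refine hcyc _ (fun x y z => by simp only [hsymm]) fun x y z => ?_
      have := hder (T x) (A (T y)) (A (T z))
      rw [hbA, hAb, hAA (T y), hTAT, hTAT, hsmul, hsmul, hξA, hξA, inner_smul_right,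
        inner_smul_right, real_inner_comm (b _ _), real_inner_comm (b _ _)] at this
      simp only [neg_zero, inner_zero_left] at this
      linarith
    intro x y z
    rw [hbT, inner_smul_left, h2, mul_zero]
  rw [← sub_eq_zero]
  refine hzero _ ?_ (fun z => ?_) (fun z => ?_)
  · rw [inner_sub_left, inner_smul_left, hξ, hξb]; simp
  · rw [inner_sub_left, inner_smul_left, hbAT, real_inner_comm _ ξ, hξA]; simp
  · rw [inner_sub_left, inner_smul_left, ← hadj, hAb, real_inner_comm _ ξ, hξT]; simp

/-- If the range of `A` is at most one-dimensional and `A A* + A* A` is a nonzero multiple of the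
projection to the orthogonal complement of `ξ`, then the dimension is at most 3. -/
theorem finrank_le_three_of_rank_le_one [FiniteDimensional ℝ V]
    (hAT : ∀ v, A (T v) + T (A v) = (4 : ℝ) • (v - (inner ℝ v ξ : ℝ) • ξ))
    (h : ∀ u v, (inner ℝ (A u) (A v) : ℝ) ^ 2 = inner ℝ (A u) (A u) * inner ℝ (A v) (A v)) :
    Module.finrank ℝ V ≤ 3 := by
  obtain ⟨a, ha⟩ : ∃ a, ∀ v, A v ∈ Submodule.span ℝ {a} := by
    by_cases h0 : ∀ v, A v = 0
    · exact ⟨0, fun v => by simp [h0 v]⟩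
    · push Not at h0
      obtain ⟨u, hu⟩ := h0
      refine ⟨A u, fun v => Submodule.mem_span_singleton.2
        ⟨(inner ℝ (A u) (A v) : ℝ) / inner ℝ (A u) (A u), ?_⟩⟩
      -- Equality in Cauchy–Schwarz: `A v` is its own projection to the line of `A u`.
      have hu' : (inner ℝ (A u) (A u) : ℝ) ≠ 0 := inner_self_ne_zero.2 hu
      rw [← sub_eq_zero, ← inner_self_eq_zero (𝕜 := ℝ)]
      simp only [inner_sub_left, inner_sub_right, inner_smul_left, inner_smul_right,
        real_inner_comm (A u) (A v)]
      have := h u v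
      simp only [conj_trivial]
      field_simp
      linarith
  classical
  have hspan : (⊤ : Submodule ℝ V) ≤ Submodule.span ℝ (({ξ, a, T a} : Finset V) : Set V) := by
    intro v _
    have hv : v = (inner ℝ v ξ : ℝ) • ξ + (1 / 4 : ℝ) • (A (T v) + T (A v)) := by
      rw [hAT]; module
    obtain ⟨r, hr⟩ := Submodule.mem_span_singleton.1 (ha (T v))
    obtain ⟨s, hs⟩ := Submodule.mem_span_singleton.1 (ha v)
    rw [hv, ← hr, ← hs, map_smul]
    have hm : ∀ w ∈ ({ξ, a, T a} : Finset V),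
        ∀ r : ℝ, r • w ∈ Submodule.span ℝ (({ξ, a, T a} : Finset V) : Set V) :=
      fun w hw r => Submodule.smul_mem _ r (Submodule.subset_span hw)
    exact add_mem (hm ξ (by simp) _)
      (Submodule.smul_mem _ _ (add_mem (hm a (by simp) _) (hm (T a) (by simp) _)))
  calc Module.finrank ℝ V = Module.finrank ℝ (⊤ : Submodule ℝ V) := finrank_top ℝ V |>.symm
    _ ≤ _ := Submodule.finrank_mono hspan
    _ ≤ _ := finrank_span_finset_le_card _
    _ ≤ 3 := Finset.card_le_three

end LinearAlgebra

/-! ### Extension and smoothness of vector fields. -/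

section Smoothness

variable {E : Type*} [NormedAddCommGroup E] [NormedSpace ℝ E]
  {H : Type*} [TopologicalSpace H] {I : ModelWithCorners ℝ E H}
  {M : Type*} [TopologicalSpace M] [ChartedSpace H M] [IsManifold I ∞ M]

/-- A vector field which is smooth near `p` agrees near `p` with a smooth vector field. -/
theorem exists_isSmoothVectorField_eq [FiniteDimensional ℝ E] [T2Space M] {p : M}
    (v : TangentSpace I p) :
    ∃ X : Π q : M, TangentSpace I q, IsSmoothVectorField I X ∧ X p = v := by
  obtain ⟨s, hs, hX⟩ := FiberBundle.exists_contMDiffOn_extend (k := ∞) I E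
    (V := fun q : M => TangentSpace I q) v
  obtain ⟨f, -, hf⟩ := (SmoothBumpFunction.nhds_basis_tsupport (I := I) p).mem_iff.1
    (interior_mem_nhds.2 hs)
  refine ⟨(f : M → ℝ) • (FiberBundle.extend E v : Π q : M, TangentSpace I q), ?_, ?_⟩
  · exact ContMDiffOn.smul_section_of_tsupport (u := interior s) f.contMDiff.contMDiffOn
      isOpen_interior hf (hX.mono interior_subset)
  · simp

theorem contMDiffAt_mvfderiv_apply {f : M → ℝ} {X : Π q : M, TangentSpace I q} {p : M}
    (hf : CMDiffAt ∞ f p) (hX : CMDiffAt ∞ (T% X) p) :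
    CMDiffAt ∞ (fun q => mvfderiv I f q (X q)) p := by
  have h1 := hf.mfderiv_const (m := ∞) (by simp)
  have h2 := ContMDiffAt.clm_apply_of_inCoordinates (b₁ := id) (b₂ := f) (m₀ := p)
    (E₁ := fun q : M => TangentSpace I q) (E₂ := fun q : ℝ => TangentSpace 𝓘(ℝ, ℝ) q) 
    (ϕ := fun q => mfderiv I 𝓘(ℝ, ℝ) f q) (v := X) h1 hX hf
  exact (contMDiff_snd_tangentBundle_modelSpace ℝ 𝓘(ℝ, ℝ)).contMDiffAt.comp p h2

theorem IsSmoothVectorField.mdiffAt {X : Π p : M, TangentSpace I p} (hX : IsSmoothVectorField I X)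
    (p : M) : MDiffAt (T% X) p :=
  (hX p).mdifferentiableAt (by simp)

end Smoothness

/-! ### Smoothness of the Levi-Civita connection. -/

section Metric

variable {E : Type*} [NormedAddCommGroup E] [NormedSpace ℝ E]
  {H : Type*} [TopologicalSpace H] {I : ModelWithCorners ℝ E H}
  {M : Type*} [TopologicalSpace M] [ChartedSpace H M] [IsManifold I ∞ M]
  [RiemannianBundle (fun p : M => TangentSpace I p)]
  [IsContMDiffRiemannianBundle I ∞ E (fun p : M => TangentSpace I p)]

theorem contMDiffAt_inner {X Y : Π p : M, TangentSpace I p} {p : M}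
    (hX : CMDiffAt ∞ (T% X) p) (hY : CMDiffAt ∞ (T% Y) p) :
    CMDiffAt ∞ (fun q => (inner ℝ (X q) (Y q) : ℝ)) p :=
  ContMDiffAt.inner_bundle (F := E) (E := fun p : M => TangentSpace I p) (b := id) hX hY

/-- The Gram-Schmidt orthogonalization of a family of vector fields. -/
def gramSchmidtField {k : ℕ} (s : Fin k → Π p : M, TangentSpace I p) (i : Fin k) :
    Π p : M, TangentSpace I p :=
  fun q => InnerProductSpace.gramSchmidt ℝ (fun j => s j q) i

theorem contMDiffAt_gramSchmidtField {k : ℕ} {s : Fin k → Π p : M, TangentSpace I p} {p : M}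
    (hs : ∀ i, CMDiffAt ∞ (T% (s i)) p) (hli : LinearIndependent ℝ fun i => s i p) (i : Fin k) :
    CMDiffAt ∞ (T% (gramSchmidtField s i)) p := by
  induction i using WellFoundedLT.induction with
  | ind i ih =>
    have h : gramSchmidtField s i = s i - fun q => ∑ j ∈ Finset.Iio i,
        ((inner ℝ (gramSchmidtField s j q) (s i q) : ℝ) /
          inner ℝ (gramSchmidtField s j q) (gramSchmidtField s j q)) •
            gramSchmidtField s j q := by
      ext q
      simp only [gramSchmidtField, Pi.sub_apply]
      rw [InnerProductSpace.gramSchmidt_def]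
      simp [Submodule.starProjection_singleton]
    rw [h]
    refine (hs i).sub_section (ContMDiffAt.sum_section fun j hj => ?_)
    have hj' := ih j (Finset.mem_Iio.1 hj)
    refine ContMDiffAt.smul_section ?_ hj'
    refine (contMDiffAt_inner hj' (hs i)).div₀ (contMDiffAt_inner hj' hj') ?_
    exact inner_self_ne_zero.2 (InnerProductSpace.gramSchmidt_ne_zero j hli)

variable [FiniteDimensional ℝ E]

theorem contMDiffAt_koszul {X Y Z : Π p : M, TangentSpace I p} {p : M}
    (hX : CMDiffAt ∞ (T% X) p) (hY : CMDiffAt ∞ (T% Y) p) (hZ : CMDiffAt ∞ (T% Z) p) :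
    CMDiffAt ∞ (koszul I X Y Z) p := by
  have : CompleteSpace E := FiniteDimensional.complete ℝ E
  have : IsManifold I ((⊤ : ℕ∞) + 1) M := ‹IsManifold I ∞ M›
  have : IsManifold I (minSmoothness ℝ 2) M := by
    rw [minSmoothness_of_isRCLikeNormedField]; infer_instance
  have hb : ∀ {U V : Π p : M, TangentSpace I p}, CMDiffAt ∞ (T% U) p → CMDiffAt ∞ (T% V) p →
      CMDiffAt ∞ (T% (mlieBracket I U V)) p := fun hU hV =>
    ContMDiffAt.mlieBracket_vectorField (m := ⊤) (n := ⊤) hU hV (by simp)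
  exact (((((contMDiffAt_mvfderiv_apply (contMDiffAt_inner hY hZ) hX).add
    (contMDiffAt_mvfderiv_apply (contMDiffAt_inner hZ hX) hY)).sub
    (contMDiffAt_mvfderiv_apply (contMDiffAt_inner hX hY) hZ)).sub
    (contMDiffAt_inner hX (hb hY hZ))).sub (contMDiffAt_inner hY (hb hX hZ))).add
    (contMDiffAt_inner hZ (hb hX hY))

/-- The coefficients of `V` in a smooth orthogonal local frame are quotients of inner products.
Leaving the frame unnormalized avoids square roots. -/
theorem contMDiffAt_of_inner {V : Π p : M, TangentSpace I p} {p : M}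
    (h : ∀ Z : Π p : M, TangentSpace I p, CMDiffAt ∞ (T% Z) p →
      CMDiffAt ∞ (fun q => (inner ℝ (V q) (Z q) : ℝ)) p) :
    CMDiffAt ∞ (T% V) p := by
  let e := trivializationAt E (fun q : M => TangentSpace I q) p
  let b := Module.finBasis ℝ E
  have hp : p ∈ e.baseSet := FiberBundle.mem_baseSet_trivializationAt' p
  have hframe := e.isLocalFrameOn_localFrame_baseSet I ∞ b
  let g := gramSchmidtField (e.localFrame b)
  have hg : ∀ i, CMDiffAt ∞ (T% (g i)) p := fun i => contMDiffAt_gramSchmidtField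
    (fun j => hframe.contMDiffAt e.open_baseSet hp j) (hframe.linearIndependent hp) i
  have hne : ∀ i, (inner ℝ (g i p) (g i p) : ℝ) ≠ 0 := fun i => inner_self_ne_zero.2
    (InnerProductSpace.gramSchmidt_ne_zero i (hframe.linearIndependent hp))
  have hsum : CMDiffAt ∞ (T% (fun q => ∑ i, ((inner ℝ (V q) (g i q) : ℝ) /
      inner ℝ (g i q) (g i q)) • g i q : Π q : M, TangentSpace I q)) p :=
    ContMDiffAt.sum_section fun i _ => ContMDiffAt.smul_section
      ((h _ (hg i)).div₀ (contMDiffAt_inner (hg i) (hg i)) (hne i)) (hg i)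
  refine hsum.congr_of_eventuallyEq ?_
  filter_upwards [e.open_baseSet.mem_nhds hp] with q hq
  congr 1
  have hon := InnerProductSpace.gramSchmidtNormed_orthonormal (hframe.linearIndependent hq)
  let o := OrthonormalBasis.mk hon (by
    rw [InnerProductSpace.span_gramSchmidtNormed_range, InnerProductSpace.span_gramSchmidt]
    exact hframe.generating hq)
  conv_lhs => rw [← o.sum_repr (V q)]
  refine Finset.sum_congr rfl fun i _ => ?_
  have ho : o i = (‖g i q‖ : ℝ)⁻¹ • g i q := by
    simp [o, InnerProductSpace.gramSchmidtNormed, g, gramSchmidtField]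
  rw [o.repr_apply_apply, ho, inner_smul_left, smul_smul, real_inner_self_eq_norm_sq,
    real_inner_comm]
  congr 1
  simp only [map_inv₀, conj_trivial]
  ring

theorem mvfderiv_inner {Y Z : Π p : M, TangentSpace I p} {p : M} (hY : MDiffAt (T% Y) p)
    (hZ : MDiffAt (T% Z) p) (X : Π p : M, TangentSpace I p) :
    mvfderiv I (fun q => (inner ℝ (Y q) (Z q) : ℝ)) p (X p) =
      inner ℝ (nabla I X Y p) (Z p) + inner ℝ (Y p) (nabla I X Z p) :=
  (leviCivita_isMetricCompatible I).mvfderiv_inner_eq X hY hZ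

theorem mlieBracket_eq_nabla {X Y : Π p : M, TangentSpace I p} {p : M} (hX : MDiffAt (T% X) p)
    (hY : MDiffAt (T% Y) p) : mlieBracket I X Y p = nabla I X Y p - nabla I Y X p := by
  have : CompleteSpace E := FiniteDimensional.complete ℝ E
  exact ((leviCivita I).torsion_eq_zero_iff.1 (leviCivita_torsion I) hX hY).symm

theorem two_mul_inner_nabla {X Y Z : Π p : M, TangentSpace I p} {p : M}
    (hX : MDiffAt (T% X) p) (hY : MDiffAt (T% Y) p) (hZ : MDiffAt (T% Z) p) :
    2 * inner ℝ (nabla I X Y p) (Z p) = koszul I X Y Z p := by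
  simp only [koszul, mlieBracket_eq_nabla hX hY, mlieBracket_eq_nabla hX hZ,
    mlieBracket_eq_nabla hY hZ, mvfderiv_inner hY hZ, mvfderiv_inner hX hY, mvfderiv_inner hZ hX,
    inner_sub_right]
  rw [real_inner_comm (nabla I X Z p), real_inner_comm (nabla I Y Z p),
    real_inner_comm (nabla I Y X p), real_inner_comm (nabla I X Y p),
    real_inner_comm (nabla I Z X p), real_inner_comm (nabla I Z Y p)]
  ring

/-- `leviCivita` is chosen with no smoothness built in; the Koszul formula supplies it by duality.
-/
theorem IsSmoothVectorField.nabla {X Y : Π p : M, TangentSpace I p}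
    (hX : IsSmoothVectorField I X) (hY : IsSmoothVectorField I Y) :
    IsSmoothVectorField I (nabla I X Y) := by
  intro p
  refine contMDiffAt_of_inner fun Z hZ => ?_
  refine ((contMDiffAt_const (c := (1 / 2 : ℝ))).mul
    (contMDiffAt_koszul (hX p) (hY p) hZ)).congr_of_eventuallyEq ?_
  -- The Koszul formula is needed at all points near `p`, so `Z` must be differentiable there;
  -- finite order `1` passes to a neighbourhood.
  obtain ⟨u, hu, hZu⟩ := (contMDiffAt_iff_contMDiffAt_nhds (n := 1) (by simp)).1 (hZ.of_le (by simp))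
    |>.exists_mem
  filter_upwards [hu] with q hq
  have := two_mul_inner_nabla (hX.mdiffAt q) (hY.mdiffAt q)
    ((hZu q hq).mdifferentiableAt one_ne_zero)
  simp only [Pi.mul_apply]
  linarith

end Metric

/-! ### Rules for `∇`, and the vanishing of `∇R`. -/

section Calculus

variable {E : Type*} [NormedAddCommGroup E] [NormedSpace ℝ E] [FiniteDimensional ℝ E]
  {H : Type*} [TopologicalSpace H] {I : ModelWithCorners ℝ E H}
  {M : Type*} [TopologicalSpace M] [ChartedSpace H M] [IsManifold I ∞ M]
  [RiemannianBundle (fun p : M => TangentSpace I p)]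
  [IsContMDiffRiemannianBundle I ∞ E (fun p : M => TangentSpace I p)]

theorem nabla_add {Y Z : Π p : M, TangentSpace I p} {p : M} (X : Π p : M, TangentSpace I p)
    (hY : MDiffAt (T% Y) p) (hZ : MDiffAt (T% Z) p) :
    nabla I X (Y + Z) p = nabla I X Y p + nabla I X Z p := by
  simp [nabla, (leviCivita I).isCovariantDerivativeOnUniv.add hY hZ]

theorem nabla_smul {f : M → ℝ} {Y : Π p : M, TangentSpace I p} {p : M}
    (X : Π p : M, TangentSpace I p) (hf : MDiffAt f p) (hY : MDiffAt (T% Y) p) :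
    nabla I X (f • Y) p = f p • nabla I X Y p + mvfderiv I f p (X p) • Y p := by
  simp [nabla, (leviCivita I).isCovariantDerivativeOnUniv.leibniz hY hf]

theorem nabla_const_smul {Y : Π p : M, TangentSpace I p} {p : M} (X : Π p : M, TangentSpace I p)
    (c : ℝ) (hY : MDiffAt (T% Y) p) : nabla I X (c • Y) p = c • nabla I X Y p := by
  have h : c • Y = (fun _ : M => c) • Y := rfl
  rw [h, nabla_smul X mdifferentiableAt_const hY]
  simp [mvfderiv_const]

theorem nabla_sub {Y Z : Π p : M, TangentSpace I p} {p : M} (X : Π p : M, TangentSpace I p)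
    (hY : MDiffAt (T% Y) p) (hZ : MDiffAt (T% Z) p) :
    nabla I X (Y - Z) p = nabla I X Y p - nabla I X Z p := by
  have h : Y - Z = Y + (-1 : ℝ) • Z := by module
  have hZ' : MDiffAt (T% ((-1 : ℝ) • Z)) p :=
    (mdifferentiableAt_const (c := (-1 : ℝ))).smul_section hZ
  rw [h, nabla_add X hY hZ', nabla_const_smul X _ hZ]
  module

theorem nabla_zero (X : Π p : M, TangentSpace I p) : nabla I X 0 = 0 := by
  ext p
  simp [nabla]

theorem curvature_eq {X Y Z : Π p : M, TangentSpace I p} {p : M} (hX : MDiffAt (T% X) p)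
    (hY : MDiffAt (T% Y) p) :
    curvature I X Y Z p = nabla I X (nabla I Y Z) p - nabla I Y (nabla I X Z) p
      - (leviCivita I Z p (nabla I X Y p) - leviCivita I Z p (nabla I Y X p)) := by
  rw [curvature, ← map_sub, ← mlieBracket_eq_nabla hX hY]
  rfl

theorem IsFlat.nablaCurvature_eq_zero (h : IsFlat I M) {W X Y Z : Π p : M, TangentSpace I p}
    (hW : IsSmoothVectorField I W) (hX : IsSmoothVectorField I X) (hY : IsSmoothVectorField I Y)
    (hZ : IsSmoothVectorField I Z) : nablaCurvature I W X Y Z = 0 := by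
  ext p
  have h0 : curvature I X Y Z = 0 := funext (h X Y Z hX hY hZ)
  simp [nablaCurvature, h0, nabla_zero, h _ _ _ (hW.nabla hX) hY hZ p,
    h _ _ _ hX (hW.nabla hY) hZ p, h _ _ _ hX hY (hW.nabla hZ) p]

/-- `R` is built from the metric and a constant, and the metric is parallel. -/
theorem HasConstantCurvature.nablaCurvature_eq_zero {c : ℝ} (h : HasConstantCurvature I M c)
    {W X Y Z : Π p : M, TangentSpace I p} (hW : IsSmoothVectorField I W)
    (hX : IsSmoothVectorField I X) (hY : IsSmoothVectorField I Y)
    (hZ : IsSmoothVectorField I Z) : nablaCurvature I W X Y Z = 0 := by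
  ext p
  have h0 : curvature I X Y Z = c • ((fun q => (inner ℝ (Y q) (Z q) : ℝ)) • X
      - (fun q => (inner ℝ (X q) (Z q) : ℝ)) • Y) := funext (h X Y Z hX hY hZ)
  have hf := mdiffAt_inner I (hY.mdiffAt p) (hZ.mdiffAt p)
  have hg := mdiffAt_inner I (hX.mdiffAt p) (hZ.mdiffAt p)
  have h1 := hf.smul_section (hX.mdiffAt p)
  have h2 := hg.smul_section (hY.mdiffAt p)
  rw [nablaCurvature, h0, nabla_const_smul _ _ (mdifferentiableAt_sub_section h1 h2),
    nabla_sub _ h1 h2, nabla_smul _ hf (hX.mdiffAt p), nabla_smul _ hg (hY.mdiffAt p),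
    mvfderiv_inner (hY.mdiffAt p) (hZ.mdiffAt p), mvfderiv_inner (hX.mdiffAt p) (hZ.mdiffAt p),
    h _ _ _ (hW.nabla hX) hY hZ p, h _ _ _ hX (hW.nabla hY) hZ p, h _ _ _ hX hY (hW.nabla hZ) p]
  simp only [Pi.zero_apply]
  module

end Calculus

/-! ### The endomorphism `∇ξ` and the Hessian of `ξ`. -/

section Contact

variable {E : Type*} [NormedAddCommGroup E] [NormedSpace ℝ E]
  {H : Type*} [TopologicalSpace H] {I : ModelWithCorners ℝ E H}
  {M : Type*} [TopologicalSpace M] [ChartedSpace H M] [IsManifold I ∞ M]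
  [RiemannianBundle (fun p : M => TangentSpace I p)] {n : ℕ}

namespace ContactMetricStructure

variable (S : ContactMetricStructure I n M) {X Y Z : Π p : M, TangentSpace I p}

theorem isSmooth_φ (hX : IsSmoothVectorField I X) :
    IsSmoothVectorField I (fun q => S.φ q (X q)) :=
  ContMDiff.clm_bundle_apply (F₁ := E) (F₂ := E) (E₁ := fun q : M => TangentSpace I q)
    (E₂ := fun q : M => TangentSpace I q) (b := id) S.smooth_φ hX

theorem inner_ξ_ξ (p : M) : inner ℝ (S.ξ p) (S.ξ p) = (1 : ℝ) := by
  rw [← S.η_eq, S.η_ξ]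

theorem φ_φ (p : M) (v : TangentSpace I p) :
    S.φ p (S.φ p v) = -v + (inner ℝ v (S.ξ p) : ℝ) • S.ξ p := by
  rw [S.φ_sq, S.η_eq]

variable [FiniteDimensional ℝ E]
  [IsContMDiffRiemannianBundle I ∞ E (fun p : M => TangentSpace I p)]

/-- The endomorphism `∇ξ` of the tangent space at `p`. -/
def gradξ (p : M) : TangentSpace I p →ₗ[ℝ] TangentSpace I p :=
  (leviCivita I S.ξ p : TangentSpace I p →L[ℝ] TangentSpace I p)

/-- The adjoint `∇ξ + 2φ` of `∇ξ`. -/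
def gradξAdj (p : M) : TangentSpace I p →ₗ[ℝ] TangentSpace I p :=
  S.gradξ p + (2 : ℝ) • (S.φ p : TangentSpace I p →ₗ[ℝ] TangentSpace I p)

/-- The second covariant derivative `∇²_{X, Y} ξ`. -/
def hessξField (X Y : Π p : M, TangentSpace I p) (p : M) : TangentSpace I p :=
  nabla I X (fun q => S.gradξ q (Y q)) p - S.gradξ p (nabla I X Y p)

theorem gradξAdj_apply (p : M) (v : TangentSpace I p) :
    S.gradξAdj p v = S.gradξ p v + (2 : ℝ) • S.φ p v := rfl

theorem isSmooth_gradξ (hX : IsSmoothVectorField I X) :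
    IsSmoothVectorField I (fun q => S.gradξ q (X q)) :=
  hX.nabla S.smooth_ξ

theorem isSmooth_gradξAdj (hX : IsSmoothVectorField I X) :
    IsSmoothVectorField I (fun q => S.gradξAdj q (X q)) :=
  (S.isSmooth_gradξ hX).add_section ((S.isSmooth_φ hX).const_smul_section (a := (2 : ℝ)))

theorem extDerivOneForm_eq (hX : IsSmoothVectorField I X) (hY : IsSmoothVectorField I Y) (p : M) :
    extDerivOneForm I S.η X Y p = (1 / 2 : ℝ) *
      ((inner ℝ (Y p) (S.gradξ p (X p)) : ℝ) - inner ℝ (X p) (S.gradξ p (Y p))) := by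
  simp only [extDerivOneForm, S.η_eq]
  rw [mvfderiv_inner (hY.mdiffAt p) (S.smooth_ξ.mdiffAt p),
    mvfderiv_inner (hX.mdiffAt p) (S.smooth_ξ.mdiffAt p),
    mlieBracket_eq_nabla (hX.mdiffAt p) (hY.mdiffAt p), inner_sub_left]
  change _ = (1 / 2 : ℝ) * ((inner ℝ (Y p) (nabla I X S.ξ p) : ℝ) - inner ℝ (X p) (nabla I Y S.ξ p))
  ring

theorem nabla_gradξ (X Y : Π p : M, TangentSpace I p) (p : M) :
    nabla I X (fun q => S.gradξ q (Y q)) p = S.gradξ p (nabla I X Y p) + S.hessξField X Y p := by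
  simp [hessξField]

/-- As `∇` is torsion-free, the skew part of the Hessian is `R(X, Y)ξ`. -/
theorem hessξField_symm (hflat : IsFlat I M) (hX : IsSmoothVectorField I X)
    (hY : IsSmoothVectorField I Y) (p : M) :
    S.hessξField X Y p = S.hessξField Y X p := by
  have h := hflat X Y S.ξ hX hY S.smooth_ξ p
  rw [curvature_eq (hX.mdiffAt p) (hY.mdiffAt p)] at h
  rw [← sub_eq_zero, ← h]
  simp only [hessξField]
  change nabla I X (nabla I Y S.ξ) p - leviCivita I S.ξ p (nabla I X Y p) -
    (nabla I Y (nabla I X S.ξ) p - leviCivita I S.ξ p (nabla I Y X p)) = _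
  abel

variable [T2Space M]

theorem inner_gradξ_ξ (p : M) (v : TangentSpace I p) : inner ℝ (S.gradξ p v) (S.ξ p) = (0 : ℝ) := by
  obtain ⟨X, hX, rfl⟩ := exists_isSmoothVectorField_eq (I := I) v
  have h := mvfderiv_inner (S.smooth_ξ.mdiffAt p) (S.smooth_ξ.mdiffAt p) X
  simp only [S.inner_ξ_ξ, mvfderiv_const, real_inner_comm (nabla I X S.ξ p)] at h
  change inner ℝ (nabla I X S.ξ p) (S.ξ p) = (0 : ℝ)
  simp at h
  linarith

theorem inner_gradξ_left (p : M) (u v : TangentSpace I p) :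
    inner ℝ (S.gradξ p u) v = (inner ℝ u (S.gradξAdj p v) : ℝ) := by
  obtain ⟨X, hX, rfl⟩ := exists_isSmoothVectorField_eq (I := I) u
  obtain ⟨Y, hY, rfl⟩ := exists_isSmoothVectorField_eq (I := I) v
  have h := S.dη_eq X Y hX hY p
  rw [S.extDerivOneForm_eq hX hY] at h
  rw [gradξAdj_apply, inner_add_right, inner_smul_right, ← h, real_inner_comm]
  ring

theorem inner_gradξAdj_left (p : M) (u v : TangentSpace I p) :
    inner ℝ (S.gradξAdj p u) v = (inner ℝ u (S.gradξ p v) : ℝ) := by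
  rw [real_inner_comm, ← inner_gradξ_left, real_inner_comm]

theorem gradξ_ξ (p : M) : S.gradξ p (S.ξ p) = 0 := by
  refine ext_inner_right ℝ fun v => ?_
  obtain ⟨X, hX, rfl⟩ := exists_isSmoothVectorField_eq (I := I) v
  have h := S.dη_ξ X hX p
  rw [S.extDerivOneForm_eq S.smooth_ξ hX, real_inner_comm (S.gradξ p (X p)),
    S.inner_gradξ_ξ] at h
  rw [inner_zero_left, real_inner_comm]
  linarith

theorem gradξAdj_ξ (p : M) : S.gradξAdj p (S.ξ p) = 0 := by
  refine ext_inner_left ℝ fun v => ?_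
  rw [← S.inner_gradξ_left, S.inner_gradξ_ξ, inner_zero_right]

theorem inner_gradξAdj_ξ (p : M) (v : TangentSpace I p) :
    inner ℝ (S.gradξAdj p v) (S.ξ p) = (0 : ℝ) := by
  rw [S.inner_gradξAdj_left, S.gradξ_ξ, inner_zero_right]

theorem hessξField_ξ (X : Π p : M, TangentSpace I p) (p : M) :
    S.hessξField X S.ξ p = -S.gradξ p (S.gradξ p (X p)) := by
  have h : (fun q => S.gradξ q (S.ξ q)) = 0 := funext S.gradξ_ξ
  rw [hessξField, h, nabla_zero]
  simp only [Pi.zero_apply, zero_sub]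
  rfl

/-- `∇_X T` is the adjoint of `∇_X A`, since `∇` is metric. -/
theorem inner_nabla_gradξAdj (X : Π p : M, TangentSpace I p) (hY : IsSmoothVectorField I Y)
    (hZ : IsSmoothVectorField I Z) (p : M) :
    inner ℝ (nabla I X (fun q => S.gradξAdj q (Y q)) p) (Z p) =
      (inner ℝ (S.gradξAdj p (nabla I X Y p)) (Z p) : ℝ) +
        inner ℝ (Y p) (S.hessξField X Z p) := by
  have h1 := mvfderiv_inner ((S.isSmooth_gradξAdj hY).mdiffAt p) (hZ.mdiffAt p) X
  have h2 := mvfderiv_inner (hY.mdiffAt p) ((S.isSmooth_gradξ hZ).mdiffAt p) X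
  simp only [S.inner_gradξAdj_left] at h1 ⊢
  rw [h2, S.nabla_gradξ, inner_add_right] at h1
  linarith

/-! ### Consequences of flatness for `∇ξ`. -/

section Flat

variable (hflat : IsFlat I M)
include hflat

theorem nabla_ξ_gradξ (hY : IsSmoothVectorField I Y) (p : M) :
    nabla I S.ξ (fun q => S.gradξ q (Y q)) p =
      S.gradξ p (nabla I S.ξ Y p) - S.gradξ p (S.gradξ p (Y p)) := by
  rw [S.nabla_gradξ, S.hessξField_symm hflat S.smooth_ξ hY, S.hessξField_ξ, sub_eq_add_neg]

theorem nabla_ξ_gradξAdj (hY : IsSmoothVectorField I Y) (p : M) :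
    nabla I S.ξ (fun q => S.gradξAdj q (Y q)) p =
      S.gradξAdj p (nabla I S.ξ Y p) - S.gradξAdj p (S.gradξAdj p (Y p)) := by
  refine ext_inner_right ℝ fun v => ?_
  obtain ⟨Z, hZ, rfl⟩ := exists_isSmoothVectorField_eq (I := I) v
  rw [S.inner_nabla_gradξAdj _ hY hZ, S.hessξField_symm hflat S.smooth_ξ hZ, S.hessξField_ξ,
    inner_sub_left, inner_neg_right, ← S.inner_gradξAdj_left, ← S.inner_gradξAdj_left,
    sub_eq_add_neg]

theorem nabla_ξ_φ (hY : IsSmoothVectorField I Y) (p : M) :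
    nabla I S.ξ (fun q => S.φ q (Y q)) p = S.φ p (nabla I S.ξ Y p) +
      (1 / 2 : ℝ) • (S.gradξ p (S.gradξ p (Y p)) - S.gradξAdj p (S.gradξAdj p (Y p))) := by
  have h : (fun q => S.gradξAdj q (Y q)) =
      (fun q => S.gradξ q (Y q)) + (2 : ℝ) • fun q => S.φ q (Y q) := rfl
  have h1 := S.nabla_ξ_gradξAdj hflat hY p
  have hφ : IsSmoothVectorField I ((2 : ℝ) • fun q => S.φ q (Y q)) :=
    (S.isSmooth_φ hY).const_smul_section
  rw [h, nabla_add _ ((S.isSmooth_gradξ hY).mdiffAt p) (hφ.mdiffAt p),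
    nabla_const_smul _ _ ((S.isSmooth_φ hY).mdiffAt p), S.nabla_ξ_gradξ hflat hY,
    S.gradξAdj_apply p (nabla I S.ξ Y p)] at h1
  have h2 : (2 : ℝ) • nabla I S.ξ (fun q => S.φ q (Y q)) p = (2 : ℝ) • S.φ p (nabla I S.ξ Y p) +
      (S.gradξ p (S.gradξ p (Y p)) - S.gradξAdj p (S.gradξAdj p (Y p))) := by
    rw [← sub_eq_zero] at h1 ⊢
    rw [← h1]
    abel
  have h3 := congrArg (fun v => (1 / 2 : ℝ) • v) h2
  simp only [smul_add, smul_smul] at h3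
  norm_num at h3 ⊢
  rw [h3, smul_sub]

/-- Since `∇_ξ ξ = 0`, the tensor `φ² = -1 + η ⊗ ξ` is parallel along `ξ`; so `φ` anticommutes with
`∇_ξ φ = (A² - T²)/2`. -/
theorem gradξ_gradξ_eq (p : M) (v : TangentSpace I p) :
    S.gradξ p (S.gradξ p v) = S.gradξAdj p (S.gradξAdj p v) := by
  refine sq_eq_sq_of_anticommute (φ := (S.φ p : TangentSpace I p →ₗ[ℝ] TangentSpace I p))
    (S.φ_φ p) (S.gradξAdj_apply p) (S.gradξ_ξ p) (S.gradξAdj_ξ p) (S.inner_gradξ_ξ p)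
    (S.inner_gradξAdj_ξ p) (fun v => ?_) v
  obtain ⟨Y, hY, rfl⟩ := exists_isSmoothVectorField_eq (I := I) v
  have hf := mdiffAt_inner I (hY.mdiffAt p) (S.smooth_ξ.mdiffAt p)
  have h1 := S.nabla_ξ_φ hflat (S.isSmooth_φ hY) p
  have h0 : (fun q => S.φ q (S.φ q (Y q))) =
      (fun q => (inner ℝ (Y q) (S.ξ q) : ℝ)) • S.ξ - Y := by
    ext q
    rw [S.φ_φ]
    simp only [Pi.sub_apply, Pi.smul_apply']
    abel
  have hξ : nabla I S.ξ S.ξ p = 0 := S.gradξ_ξ p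
  rw [h0, nabla_sub _ (hf.smul_section (S.smooth_ξ.mdiffAt p)) (hY.mdiffAt p),
    nabla_smul _ hf (S.smooth_ξ.mdiffAt p),
    mvfderiv_inner (hY.mdiffAt p) (S.smooth_ξ.mdiffAt p), hξ, S.nabla_ξ_φ hflat hY,
    map_add, S.φ_φ, inner_zero_right, smul_zero, map_smul] at h1
  rw [← sub_eq_zero] at h1
  change S.φ p _ + _ = 0
  have h2 := congrArg (fun v => (-2 : ℝ) • v) h1
  simp only [smul_zero] at h2
  rw [← h2]
  module

/-- Differentiating `A² = T²` along `ξ` gives `-2A³ = -2T³`. -/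
theorem gradξ_gradξ (p : M) (v : TangentSpace I p) : S.gradξ p (S.gradξ p v) = 0 := by
  refine sq_eq_zero_of_cube_eq_cube (T := S.gradξAdj p)
    (φ := (S.φ p : TangentSpace I p →ₗ[ℝ] TangentSpace I p))
    (S.φ_φ p) (S.gradξAdj_apply p) (S.inner_gradξ_ξ p) (S.gradξ_gradξ_eq hflat p) (fun v => ?_) v
  obtain ⟨Y, hY, rfl⟩ := exists_isSmoothVectorField_eq (I := I) v
  have h1 := S.nabla_ξ_gradξ hflat (S.isSmooth_gradξ hY) p
  have h2 := S.nabla_ξ_gradξAdj hflat (S.isSmooth_gradξAdj hY) p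
  have h0 : (fun q => S.gradξ q (S.gradξ q (Y q))) =
    fun q => S.gradξAdj q (S.gradξAdj q (Y q)) := funext fun q => S.gradξ_gradξ_eq hflat q (Y q)
  rw [S.nabla_ξ_gradξ hflat hY, map_sub] at h1
  rw [← h0, h1, S.nabla_ξ_gradξAdj hflat hY, map_sub, S.gradξ_gradξ_eq hflat p (nabla I S.ξ Y p),
    sub_sub, sub_sub, sub_right_inj, ← two_smul ℝ, ← two_smul ℝ] at h2
  exact smul_right_injective _ (two_ne_zero (α := ℝ)) h2

theorem gradξAdj_gradξAdj (p : M) (v : TangentSpace I p) :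
    S.gradξAdj p (S.gradξAdj p v) = 0 := by
  rw [← S.gradξ_gradξ_eq hflat, S.gradξ_gradξ hflat]

theorem gradξ_gradξAdj_add (p : M) (v : TangentSpace I p) :
    S.gradξ p (S.gradξAdj p v) + S.gradξAdj p (S.gradξ p v) =
      (4 : ℝ) • (v - (inner ℝ v (S.ξ p) : ℝ) • S.ξ p) := by
  have h1 := S.gradξAdj_gradξAdj hflat p v
  have h2 := S.gradξ_gradξ hflat p v
  have h3 := S.φ_φ p v
  simp only [gradξAdj_apply, map_add, map_smul, h2, h3, zero_add] at h1 ⊢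
  rw [← sub_eq_zero, ← h1]
  module

/-- The derivative of `A² = 0`. -/
theorem hessξField_gradξ (X Y : Π p : M, TangentSpace I p) (p : M) :
    S.hessξField X (fun q => S.gradξ q (Y q)) p = -S.gradξ p (S.hessξField X Y p) := by
  have h : (fun q => S.gradξ q (S.gradξ q (Y q))) = 0 := funext fun q => S.gradξ_gradξ hflat q (Y q)
  have h1 := S.nabla_gradξ X (fun q => S.gradξ q (Y q)) p
  rw [h, nabla_zero, S.nabla_gradξ, map_add, S.gradξ_gradξ hflat, zero_add, Pi.zero_apply] at h1
  exact (neg_eq_of_add_eq_zero_right h1.symm).symm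

-- The derivative of `⟨AY, ξ⟩ = 0`.
omit hflat in
theorem inner_hessξField_ξ (X : Π p : M, TangentSpace I p) (hY : IsSmoothVectorField I Y) (p : M) :
    inner ℝ (S.hessξField X Y p) (S.ξ p) = -(inner ℝ (S.gradξ p (X p)) (S.gradξ p (Y p)) : ℝ) := by
  have h := mvfderiv_inner ((S.isSmooth_gradξ hY).mdiffAt p) (S.smooth_ξ.mdiffAt p) X
  simp only [S.inner_gradξ_ξ, mvfderiv_const, S.nabla_gradξ, inner_add_left] at h
  rw [real_inner_comm (S.gradξ p (Y p))]
  change _ = -(inner ℝ (S.gradξ p (Y p)) (nabla I X S.ξ p) : ℝ)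
  simp at h
  linarith

/-- The derivative of `AT + TA = 4(1 - η ⊗ ξ)` along `X`, applied to `Y` and paired with `Z`. -/
theorem inner_hessξField_add (X : Π p : M, TangentSpace I p) (hY : IsSmoothVectorField I Y)
    (hZ : IsSmoothVectorField I Z) (p : M) :
    inner ℝ (Y p) (S.hessξField X (fun q => S.gradξAdj q (Z q)) p) +
      inner ℝ (Z p) (S.hessξField X (fun q => S.gradξAdj q (Y q)) p) +
      inner ℝ (S.hessξField X Y p) (S.gradξ p (Z p)) +
      inner ℝ (S.gradξ p (Y p)) (S.hessξField X Z p) =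
    -4 * ((inner ℝ (Y p) (S.gradξ p (X p)) : ℝ) * inner ℝ (Z p) (S.ξ p) +
      (inner ℝ (Y p) (S.ξ p) : ℝ) * inner ℝ (Z p) (S.gradξ p (X p))) := by
  have hf := mdiffAt_inner I (hY.mdiffAt p) (S.smooth_ξ.mdiffAt p)
  have hA := S.isSmooth_gradξ hY
  have hT := S.isSmooth_gradξAdj hY
  have hfξ := hf.smul_section (S.smooth_ξ.mdiffAt p)
  have h0 : (fun q => S.gradξ q (S.gradξAdj q (Y q))) + (fun q => S.gradξAdj q (S.gradξ q (Y q))) =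
      (4 : ℝ) • (Y - (fun q => (inner ℝ (Y q) (S.ξ q) : ℝ)) • S.ξ) :=
    funext fun q => S.gradξ_gradξAdj_add hflat q (Y q)
  have h1 := congrArg (fun V => (inner ℝ (nabla I X V p) (Z p) : ℝ)) h0
  have h2 := congrArg (fun v => (inner ℝ v (Z p) : ℝ)) (S.gradξ_gradξAdj_add hflat p (nabla I X Y p))
  rw [nabla_add _ ((S.isSmooth_gradξ hT).mdiffAt p) ((S.isSmooth_gradξAdj hA).mdiffAt p),
    nabla_const_smul _ _ (mdifferentiableAt_sub_section (hY.mdiffAt p) hfξ),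
    nabla_sub _ (hY.mdiffAt p) hfξ, nabla_smul _ hf (S.smooth_ξ.mdiffAt p),
    mvfderiv_inner (hY.mdiffAt p) (S.smooth_ξ.mdiffAt p), inner_add_left,
    S.inner_nabla_gradξAdj X hA hZ, S.nabla_gradξ, inner_add_left, S.inner_gradξ_left,
    S.inner_nabla_gradξAdj X hY (S.isSmooth_gradξAdj hZ), S.nabla_gradξ, map_add, inner_add_left,
    S.inner_gradξAdj_left p (S.hessξField X Y p)] at h1
  rw [inner_add_left, S.inner_gradξ_left] at h2
  simp only [inner_sub_left, inner_add_left, inner_smul_left, conj_trivial] at h1 h2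
  rw [real_inner_comm (S.hessξField X _ p) (Z p), real_inner_comm (S.ξ p) (Z p),
    real_inner_comm (S.gradξ p (X p)) (Z p)]
  change _ + _ = (4 : ℝ) * (_ - ((inner ℝ (Y p) (S.ξ p) : ℝ) * inner ℝ (S.gradξ p (X p)) (Z p) +
    ((inner ℝ (nabla I X Y p) (S.ξ p) : ℝ) + inner ℝ (Y p) (S.gradξ p (X p))) *
      inner ℝ (S.ξ p) (Z p))) at h1
  linarith

theorem hessξField_eq (X : Π p : M, TangentSpace I p) (hY : IsSmoothVectorField I Y) (p : M) :
    S.hessξField X Y p = -(inner ℝ (S.gradξ p (X p)) (S.gradξ p (Y p)) : ℝ) • S.ξ p := by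
  have hl : ∀ {X X' : Π p : M, TangentSpace I p} (Y : Π p : M, TangentSpace I p), X p = X' p →
      S.hessξField X Y p = S.hessξField X' Y p := fun Y h => by simp only [hessξField, nabla, h]
  -- Tensoriality in the second slot is inherited from the first by symmetry, so the Hessian
  -- descends to a map on tangent vectors.
  have hr : ∀ {X Y Y' : Π p : M, TangentSpace I p}, IsSmoothVectorField I X →
      IsSmoothVectorField I Y → IsSmoothVectorField I Y' → Y p = Y' p →
      S.hessξField X Y p = S.hessξField X Y' p := fun {X Y Y'} hX hY hY' h => by
    rw [S.hessξField_symm hflat hX hY, hl X h, S.hessξField_symm hflat hY' hX]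
  choose e he hep using fun v : TangentSpace I p => exists_isSmoothVectorField_eq (I := I) v
  have h := hessian_eq_of_flat (A := S.gradξ p) (T := S.gradξAdj p) (ξ := S.ξ p)
    (b := fun u v => S.hessξField (e u) (e v) p) ?_ ?_ ?_ (S.inner_ξ_ξ p) (S.inner_gradξ_left p)
    (S.gradξ_gradξ hflat p) (S.gradξAdj_gradξAdj hflat p) (S.gradξ_ξ p) (S.gradξAdj_ξ p)
    (S.gradξ_gradξAdj_add hflat p) ?_ ?_ ?_ ?_ (X p) (Y p)
  · rw [← h, hl Y (hep (X p)).symm, hr (he _) hY (he _) (hep (Y p)).symm]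
  · intro u v w
    simp only [S.hessξField_symm hflat (he u) (he _)]
    simp only [hessξField, nabla, hep, map_add]
    abel
  · intro u r v
    simp only [S.hessξField_symm hflat (he u) (he _)]
    simp only [hessξField, nabla, hep, map_smul, smul_sub]
  · exact fun u v => S.hessξField_symm hflat (he u) (he v) p
  · intro u
    rw [hr (he u) (he _) S.smooth_ξ (hep _), S.hessξField_ξ, S.gradξ_gradξ hflat, neg_zero]
  · intro u v
    rw [hr (he u) (he _) (S.isSmooth_gradξ (he v)) (by simp [hep]), S.hessξField_gradξ hflat]
  · intro u v
    rw [S.inner_hessξField_ξ _ (he v), hep, hep]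
  · intro x y z
    have := S.inner_hessξField_add hflat (e x) (he y) (he z) p
    rw [hr (he x) (he (S.gradξAdj p z)) (S.isSmooth_gradξAdj (he z)) (by simp [hep]),
      hr (he x) (he (S.gradξAdj p y)) (S.isSmooth_gradξAdj (he y)) (by simp [hep])]
    simpa only [hep] using this

theorem nabla_gradξ_of_isFlat (X : Π p : M, TangentSpace I p) (hY : IsSmoothVectorField I Y) :
    nabla I X (fun q => S.gradξ q (Y q)) = (fun q => S.gradξ q (nabla I X Y q)) -
      (fun q => (inner ℝ (S.gradξ q (X q)) (S.gradξ q (Y q)) : ℝ)) • S.ξ := by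
  ext q
  rw [S.nabla_gradξ, S.hessξField_eq hflat X hY]
  simp [sub_eq_add_neg]

theorem inner_gradξ_sq (p : M) (u v : TangentSpace I p) :
    (inner ℝ (S.gradξ p u) (S.gradξ p v) : ℝ) ^ 2 =
      inner ℝ (S.gradξ p u) (S.gradξ p u) * inner ℝ (S.gradξ p v) (S.gradξ p v) := by
  obtain ⟨X, hX, rfl⟩ := exists_isSmoothVectorField_eq (I := I) u
  obtain ⟨Z, hZ, rfl⟩ := exists_isSmoothVectorField_eq (I := I) v
  -- Terms along `ξ` are orthogonal to `A w`; what survives is `⟨AV, AW⟩ ∇_U ξ = ⟨AV, AW⟩ AU`.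
  have key : ∀ (U : Π q : M, TangentSpace I q) {V W : Π q : M, TangentSpace I q},
      IsSmoothVectorField I V → IsSmoothVectorField I W → ∀ w : TangentSpace I p,
      inner ℝ (nabla I U (nabla I V (fun q => S.gradξ q (W q))) p) (S.gradξ p w) =
        (inner ℝ (S.gradξ p (nabla I U (nabla I V W) p)) (S.gradξ p w) : ℝ) -
        (inner ℝ (S.gradξ p (V p)) (S.gradξ p (W p)) : ℝ) *
          inner ℝ (S.gradξ p (U p)) (S.gradξ p w) := by
    intro U V W hV hW w
    have hf := mdiffAt_inner I ((S.isSmooth_gradξ hV).mdiffAt p) ((S.isSmooth_gradξ hW).mdiffAt p)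
    rw [S.nabla_gradξ_of_isFlat hflat V hW, nabla_sub _ ((S.isSmooth_gradξ (hV.nabla hW)).mdiffAt p)
      (hf.smul_section (S.smooth_ξ.mdiffAt p)), S.nabla_gradξ_of_isFlat hflat U (hV.nabla hW),
      nabla_smul _ hf (S.smooth_ξ.mdiffAt p)]
    simp only [Pi.sub_apply, Pi.smul_apply', inner_sub_left, inner_add_left, inner_smul_left,
      real_inner_comm (S.gradξ p w) (S.ξ p), S.inner_gradξ_ξ, conj_trivial, mul_zero]
    change _ - ((_ * (inner ℝ (S.gradξ p (U p)) (S.gradξ p w) : ℝ)) + _) = _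
    ring
  have hbr : ∀ (U : Π q : M, TangentSpace I q) {W : Π q : M, TangentSpace I q},
      IsSmoothVectorField I W → ∀ w : TangentSpace I p,
      inner ℝ (nabla I U (fun q => S.gradξ q (W q)) p) (S.gradξ p w) =
        (inner ℝ (S.gradξ p (nabla I U W p)) (S.gradξ p w) : ℝ) := by
    intro U W hW w
    rw [S.nabla_gradξ_of_isFlat hflat U hW]
    simp [inner_sub_left, inner_smul_left, real_inner_comm (S.gradξ p w) (S.ξ p), S.inner_gradξ_ξ]
  -- Subtracting `⟨A R(Z, X)X, AZ⟩ = 0` from `⟨R(Z, X)(AX), AZ⟩ = 0` leaves `⟨AX, AZ⟩² - |AX|²|AZ|²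
  -- = 0`.
  have h1 := congrArg (fun w => (inner ℝ w (S.gradξ p (Z p)) : ℝ))
    (hflat Z X _ hZ hX (S.isSmooth_gradξ hX) p)
  have h2 := congrArg (fun w => (inner ℝ (S.gradξ p w) (S.gradξ p (Z p)) : ℝ))
    (hflat Z X X hZ hX hX p)
  simp only [curvature, inner_sub_left, map_sub, key Z hX hX, key X hZ hX, hbr _ hX, map_zero,
    inner_zero_left] at h1 h2
  rw [real_inner_comm (S.gradξ p (X p)) (S.gradξ p (Z p))] at h1
  linarith

end Flat

end ContactMetricStructure

end Contact

/-! ### Recurrence, constant curvature and the dimension bound. -/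

section Recurrent

variable {E : Type*} [NormedAddCommGroup E] [NormedSpace ℝ E] [FiniteDimensional ℝ E]
  {H : Type*} [TopologicalSpace H] {I : ModelWithCorners ℝ E H}
  {M : Type*} [TopologicalSpace M] [ChartedSpace H M] [IsManifold I ∞ M]
  [RiemannianBundle (fun p : M => TangentSpace I p)]
  [IsContMDiffRiemannianBundle I ∞ E (fun p : M => TangentSpace I p)] {n : ℕ}

namespace ContactMetricStructure

variable (S : ContactMetricStructure I n M)

theorem isPhiRecurrent_of_isFlat [Nonempty M] (hflat : IsFlat I M) : S.IsPhiRecurrent := by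
  refine ⟨S.η, S.isContactForm.1, fun h => ?_, fun W X Y Z hW hX hY hZ p => ?_⟩
  · obtain ⟨p⟩ := ‹Nonempty M›
    have := S.η_ξ p
    simp [h] at this
  · simp [hflat.nablaCurvature_eq_zero hW hX hY hZ, hflat X Y Z hX hY hZ p]

variable [T2Space M]

include S in
/-- A flat contact metric manifold has dimension at most 3. -/
theorem finrank_le_three_of_isFlat [Nonempty M] (hflat : IsFlat I M) : Module.finrank ℝ E ≤ 3 := by
  obtain ⟨p⟩ := ‹Nonempty M›
  have : FiniteDimensional ℝ (TangentSpace I p) := inferInstanceAs (FiniteDimensional ℝ E)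
  exact finrank_le_three_of_rank_le_one (V := TangentSpace I p)
    (S.gradξ_gradξAdj_add hflat p) (S.inner_gradξ_sq hflat p)

/-- A `φ`-recurrent contact metric manifold of constant curvature is flat. -/
theorem isFlat_of_isPhiRecurrent (hE : 2 ≤ Module.finrank ℝ E) (hS : S.IsPhiRecurrent) {c : ℝ}
    (hc : HasConstantCurvature I M c) : IsFlat I M := by
  obtain ⟨A, -, hA, h⟩ := hS
  obtain ⟨p, hp⟩ := Function.ne_iff.1 hA
  obtain ⟨w, hw⟩ : ∃ w, A p w ≠ 0 := by
    by_contra! h0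
    exact hp (ContinuousLinearMap.ext h0)
  obtain ⟨W, hW, rfl⟩ := exists_isSmoothVectorField_eq (I := I) w
  obtain ⟨v, hv⟩ : ∃ v : TangentSpace I p, v ∉ Submodule.span ℝ {S.ξ p} := by
    by_contra! h0
    have h1 : Module.finrank ℝ (TangentSpace I p) ≤ 1 :=
      finrank_le_one (S.ξ p) fun v => Submodule.mem_span_singleton.1 (h0 v)
    exact absurd (hE.trans h1) (by norm_num)
  obtain ⟨X, hX, rfl⟩ := exists_isSmoothVectorField_eq (I := I) v
  -- `R(X, ξ)ξ = c (X - η(X)ξ)`, and the bracket is nonzero at `p` because `X p` is not a multiple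
  -- of `ξ`.
  have h1 := h W X S.ξ S.ξ hW hX S.smooth_ξ S.smooth_ξ p
  rw [hc.nablaCurvature_eq_zero hW hX S.smooth_ξ S.smooth_ξ, Pi.zero_apply, map_zero, map_zero,
    eq_comm, smul_eq_zero, or_iff_right hw, hc _ _ _ hX S.smooth_ξ S.smooth_ξ, S.inner_ξ_ξ,
    one_smul, smul_eq_zero] at h1
  have hc0 : c = 0 := h1.resolve_right fun h2 =>
    hv (Submodule.mem_span_singleton.2 ⟨_, (sub_eq_zero.1 h2).symm⟩)
  intro X Y Z hX hY hZ q
  rw [hc X Y Z hX hY hZ, hc0, zero_smul]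

end ContactMetricStructure

end Recurrent

end

theorem mainTheorem8 (n : ℕ) (hn : 1 ≤ n) {M : Type*} [TopologicalSpace M] [T2Space M] [Nonempty M]
    [ChartedSpace (EuclideanSpace ℝ (Fin (2 * n + 1))) M]
    [IsManifold (𝓡 (2 * n + 1)) ∞ M]
    [RiemannianBundle (fun p : M => TangentSpace (𝓡 (2 * n + 1)) p)]
    [IsContMDiffRiemannianBundle (𝓡 (2 * n + 1)) ∞ (EuclideanSpace ℝ (Fin (2 * n + 1)))
      (fun p : M => TangentSpace (𝓡 (2 * n + 1)) p)]
    (S : ContactMetricStructure (𝓡 (2 * n + 1)) n M) :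
    (S.IsPhiRecurrent ∧ ∃ c : ℝ, HasConstantCurvature (𝓡 (2 * n + 1)) M c) ↔
      (n = 1 ∧ IsFlat (𝓡 (2 * n + 1)) M) := by
  have hdim : Module.finrank ℝ (EuclideanSpace ℝ (Fin (2 * n + 1))) = 2 * n + 1 := by simp
  constructor
  · rintro ⟨hS, c, hc⟩
    have hflat := S.isFlat_of_isPhiRecurrent (by omega) hS hc
    have := S.finrank_le_three_of_isFlat hflat
    exact ⟨by omega, hflat⟩
  · rintro ⟨-, hflat⟩
    exact ⟨S.isPhiRecurrent_of_isFlat hflat, 0, fun X Y Z hX hY hZ p => by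
      rw [hflat X Y Z hX hY hZ, zero_smul]⟩
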